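/- There are absolute constants $D,B>0$, a function $\varepsilon:\mathbb N\to\mathbb R$ with $\varepsilon(n)\to 0$ as $n\to\infty$, and a randomized algorithm $\mathcal A$ with the following properties. The input of $\mathcal A$ consists of a finite set $X$ of $n\ge 2$ points, an integer $k\ge 1$ and a preference profile $P=\{\pi_x\}_{x\in X}$, where each $\pi_x:\{1,\dots,n\}\to X$ is a bijection (the ranking of $x$). The algorithm has no access to distances (it makes zero distance queries) and is not given $z$. Its output is a random nonempty set of centers $\mathcal A(P)\subseteq X$. For every metric $d$ on $X$ with which $P$ is consistent, that is, $d(x,\pi_x(i))\le d(x,\pi_x(j))$ for all $x\in X$ and $i<j$, write $d(x,C)=\min_{c\in C}d(x,c)$ for $\emptyset\ne C\subseteq X$, and for an integer $z\ge 1$ put $$\phi_z(C)=\Big(\sum_{x\in X}d(x,C)^z\Big)^{1/z},\qquad \mathrm{OPT}_{k,z}=\min_{\emptyset\ne C\subseteq X,\ |C|\le k}\phi_z(C).$$ Then: 1. (number of centers) $|\mathcal A(P)|\le (B\log n)^{k+\varepsilon(n)}$ with probability $1$; 2. (with high probability) with probability at least $1-1/n$, the inequality $\phi_z(\mathcal A(P))\le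 D\cdot \mathrm{OPT}_{k,z}$ holds simultaneously for all integers $z\ge 1$; 3. (in expectation) $\mathbb E[\phi_z(\mathcal A(P))]\le D\cdot\mathrm{OPT}_{k,z}$ for every integer $z\ge 1$. -/

import Mathlib

open Filter Topology

universe u

namespace OrdinalClustering

/-- A preference profile on a finite point set `X` with `n` points: every point `x` reports a
ranking `P x`, a bijection from the positions `0, …, n - 1` to `X`; an earlier position means
a higher rank. -/
def Profile (X : Type u) [Fintype X] : Type u :=
  X → (Fin (Fintype.card X) ≃ X)

/-- The profile `P` is consistent with the metric of `X`: every point ranks closer points first,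
ties being broken arbitrarily. -/
def Profile.Consistent {X : Type u} [Fintype X] [MetricSpace X] (P : Profile X) : Prop :=
  ∀ (x : X) (i j : Fin (Fintype.card X)), i < j → dist x (P x i) ≤ dist x (P x j)

/-- A solution: a nonempty set of centers. -/
abbrev CenterSet (X : Type u) : Type u :=
  {C : Finset X // C.Nonempty}

/-- The distance `d(x, C) = min_{c ∈ C} d(x, c)`. -/
noncomputable def distTo {X : Type u} [MetricSpace X] (x : X) (C : CenterSet X) : ℝ :=
  C.1.inf' C.2 (fun c => dist x c)

/-- The `(k, z)`-clustering cost of `C`, the `z`-th root of `∑ x, d(x, C) ^ z`. -/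
noncomputable def cost {X : Type u} [Fintype X] [MetricSpace X] (z : ℕ) (C : CenterSet X) : ℝ :=
  (∑ x : X, distTo x C ^ z) ^ ((1 : ℝ) / (z : ℝ))

/-- The optimal `(k, z)`-clustering cost, over all sets of at most `k` centers. -/
noncomputable def optCost (X : Type u) [Fintype X] [MetricSpace X] (k z : ℕ) : ℝ :=
  ⨅ C : {C : CenterSet X // C.1.card ≤ k}, cost z C.1

/-- A randomized zero-query (purely ordinal) algorithm: from the point set, the number `k` and
the preference profile alone, it produces a random set of centers. It has no access to the
distances and is not told `z`. -/
def RandomizedOrdinalAlgorithm : Type (u + 1) :=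
  ∀ (X : Type u) [Fintype X] [Nonempty X], ℕ → Profile X → PMF (CenterSet X)

/-- The probability of an event under a distribution on center sets. -/
noncomputable def prob {X : Type u} (μ : PMF (CenterSet X)) (E : Set (CenterSet X)) : ℝ :=
  (μ.toOuterMeasure E).toReal

/-- The expectation of a function under a distribution on center sets of a finite set. -/
noncomputable def expectation {X : Type u} [Fintype X] (μ : PMF (CenterSet X))
    (f : CenterSet X → ℝ) : ℝ :=
  ∑ C : CenterSet X, (μ C).toReal * f C

end OrdinalClustering

/-!
The zero-query algorithm uses only comparisons of the form "does `x` rank `c` before `y`", and the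
rankings of the centers chosen so far.

Work in a region `R` with a current center `c`. Drawing a new center with probability proportional
to `d(x, c) ^ z` would be the classical way to hit a cluster that is still badly served: if `c` is
too expensive for `R`, at least half of its cost comes from points close to the optimal center of
an uncovered cluster (`sum_le_two_mul_sum_goodPoints`). Distances and `z` are unknown, but this
distribution is a mixture of uniform distributions on the superlevel sets of `d(·, c)`, and these
are the final segments of the ranking of `c`. Hence for one of the `O(log n)` scales `2 ^ l`, a
uniform point `y` among the `2 ^ l` points of `R` farthest from `c` is good with constant
probability (`exists_scale_drawFarthest`).

After drawing `y`, the region splits according to which of `c`, `y` a point prefers, and both parts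
are treated recursively and independently of each other (`treeSample`). A cluster may be cut by the
split, but this is harmless: along every branch each good draw covers one more cluster for the
whole region of that branch, so depth `k` suffices, and there are only
`(O(log n)) ^ depth` nodes. Repeating each draw a constant number of times keeps the success
probability of every subtree above `3 / 4`, because a draw succeeds as soon as `y` is good and both
subtrees succeed (`failProb_treeSample_le`). No error accumulates with the depth: the cost is
charged to a budget on the points that is merely redistributed when a cluster becomes covered
(`budget_coverBudget`) and split when the region is split.

The first center is uniform in `X`, which is good for its own cluster, so trees of depth `k - 1`
suffice; `O(log n)` independent runs make the failure probability polynomially small for each `z`.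
Scale `1` of the tree is a farthest-first traversal, so every outcome is a `2`-approximation of the
optimal covering radius (`exists_dist_le_of_mem_support_treeSample`). This settles all
`z > log₂ n` at once, leaving a union bound over the others, and it bounds the cost of a failed run
by `2 n` times the optimum, which makes the contribution of failures to the expectation negligible.
The bound on the number of centers needs no correction of the exponent, that is, `ε = 0`.
-/

namespace OrdinalClustering

open scoped Classical ENNReal

/-! ### Unions of independent random sets -/

section RandomSets

variable {X : Type u}

/-- The union of independent random sets, one drawn from each distribution in the list. -/
noncomputable def unionAll : List (PMF (Finset X)) → PMF (Finset X)
  | [] => PMF.pure ∅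
  | μ :: l => μ.bind fun A => (unionAll l).map fun A' => A ∪ A'

/-- The probability that the random set does not satisfy `E`. -/
noncomputable def failProb (μ : PMF (Finset X)) (E : Finset X → Prop) : ℝ≥0∞ :=
  μ.toOuterMeasure {A | ¬ E A}

lemma pmf_toOuterMeasure_le_one {α : Type*} (μ : PMF α) (s : Set α) :
    μ.toOuterMeasure s ≤ 1 := by
  rw [← (PMF.toOuterMeasure_apply_eq_one_iff (p := μ) (s := Set.univ)).2 (Set.subset_univ _)]
  exact MeasureTheory.measure_mono (Set.subset_univ _)

lemma failProb_le_one (μ : PMF (Finset X)) (E : Finset X → Prop) : failProb μ E ≤ 1 :=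
  pmf_toOuterMeasure_le_one _ _

lemma failProb_eq_zero {μ : PMF (Finset X)} {E : Finset X → Prop}
    (h : ∀ A ∈ μ.support, E A) : failProb μ E = 0 := by
  rw [failProb, PMF.toOuterMeasure_apply_eq_zero_iff, Set.disjoint_left]
  exact fun A hA hE => hE (h A hA)

/-- Two-stage sampling: if the second stage fails with probability at most `1 / 2` after a first
draw in `G`, the failure probability is at most the average of `1 / 2` and `1` weighted by the
probabilities of `G` and its complement. -/
lemma failProb_bind_le {α : Type*} (μ : PMF α) (f : α → PMF (Finset X)) (E : Finset X → Prop)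
    (G : Set α) (h : ∀ x ∈ G, failProb (f x) E ≤ 1 / 2) :
    failProb (μ.bind f) E ≤ 1 / 2 + 1 / 2 * μ.toOuterMeasure Gᶜ := by
  rw [failProb, PMF.toOuterMeasure_bind_apply, PMF.toOuterMeasure_apply, ← ENNReal.tsum_mul_left]
  calc ∑' x, μ x * (f x).toOuterMeasure {A | ¬ E A}
      ≤ ∑' x, (μ x * (1 / 2) + 1 / 2 * Gᶜ.indicator μ x) := by
        refine ENNReal.tsum_le_tsum fun x => ?_
        by_cases hx : x ∈ G
        · simpa [hx, failProb] using mul_le_mul_right (h x hx) (μ x)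
        · have : Gᶜ.indicator μ x = μ x := Set.indicator_of_mem hx _
          rw [this, mul_comm (1 / 2), ← mul_add, one_div, ENNReal.inv_two_add_inv_two]
          exact mul_le_mul_right (pmf_toOuterMeasure_le_one _ _) _
    _ = _ := by rw [ENNReal.tsum_add, ENNReal.tsum_mul_right, PMF.tsum_coe, one_mul]

/-- Independent sets all have to fail before their union fails an upward closed requirement. -/
lemma failProb_unionAll_cons_le {E : Finset X → Prop} (hE : ∀ A A', A ⊆ A' → E A → E A')
    (μ : PMF (Finset X)) (l : List (PMF (Finset X))) :
    failProb (unionAll (μ :: l)) E ≤ failProb μ E * failProb (unionAll l) E := by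
  rw [unionAll, failProb, PMF.toOuterMeasure_bind_apply]
  calc ∑' A, μ A * ((unionAll l).map fun A' => A ∪ A').toOuterMeasure {A | ¬ E A}
      ≤ ∑' A, {A | ¬ E A}.indicator μ A * failProb (unionAll l) E := by
        refine ENNReal.tsum_le_tsum fun A => ?_
        rw [PMF.toOuterMeasure_map_apply]
        by_cases hA : E A
        · have : (fun A' => A ∪ A') ⁻¹' {A | ¬ E A} = ∅ := by
            ext A'
            simpa using hE A _ Finset.subset_union_left hA
          simp [this]
        · rw [Set.indicator_of_mem (by exact hA)]
          refine mul_le_mul_right (MeasureTheory.measure_mono ?_) _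
          exact fun A' hA' hc => hA' (hE A' _ Finset.subset_union_right hc)
    _ = failProb μ E * failProb (unionAll l) E := by
        rw [ENNReal.tsum_mul_right, failProb, failProb, PMF.toOuterMeasure_apply μ]

lemma failProb_unionAll_le {E : Finset X → Prop} (hE : ∀ A A', A ⊆ A' → E A → E A')
    {l : List (PMF (Finset X))} {μ : PMF (Finset X)} (hμ : μ ∈ l) :
    failProb (unionAll l) E ≤ failProb μ E := by
  induction l with
  | nil => simp at hμ
  | cons ν l ih =>
    refine (failProb_unionAll_cons_le hE ν l).trans ?_
    rcases List.mem_cons.1 hμ with rfl | h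
    · exact mul_le_of_le_one_right' (failProb_le_one _ _)
    · exact (mul_le_of_le_one_left' (failProb_le_one ν E)).trans (ih h)

lemma failProb_unionAll_replicate_le {E : Finset X → Prop} (hE : ∀ A A', A ⊆ A' → E A → E A')
    (m : ℕ) (μ : PMF (Finset X)) :
    failProb (unionAll (List.replicate m μ)) E ≤ failProb μ E ^ m := by
  induction m with
  | zero => simpa using failProb_le_one _ _
  | succ m ih =>
    rw [List.replicate_succ, pow_succ']
    exact (failProb_unionAll_cons_le hE _ _).trans (mul_le_mul_right ih _)

lemma exists_subset_of_mem_support_unionAll {l : List (PMF (Finset X))} {A : Finset X}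
    (hA : A ∈ (unionAll l).support) {μ : PMF (Finset X)} (hμ : μ ∈ l) :
    ∃ A' ∈ μ.support, A' ⊆ A := by
  induction l generalizing A with
  | nil => simp at hμ
  | cons ν l ih =>
    rw [unionAll, PMF.mem_support_bind_iff] at hA
    obtain ⟨A₁, h₁, hA⟩ := hA
    obtain ⟨A₂, h₂, rfl⟩ := (PMF.mem_support_map_iff _ _ _).1 hA
    rcases List.mem_cons.1 hμ with rfl | h
    · exact ⟨A₁, h₁, Finset.subset_union_left⟩
    · obtain ⟨A', h', hs⟩ := ih h₂ h
      exact ⟨A', h', hs.trans Finset.subset_union_right⟩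

lemma card_le_of_mem_support_unionAll {l : List (PMF (Finset X))} {m : ℕ}
    (h : ∀ μ ∈ l, ∀ A ∈ μ.support, A.card ≤ m) {A : Finset X}
    (hA : A ∈ (unionAll l).support) : A.card ≤ l.length * m := by
  induction l generalizing A with
  | nil => simp_all [unionAll]
  | cons ν l ih =>
    rw [unionAll, PMF.mem_support_bind_iff] at hA
    obtain ⟨A₁, h₁, hA⟩ := hA
    obtain ⟨A₂, h₂, rfl⟩ := (PMF.mem_support_map_iff _ _ _).1 hA
    have := Finset.card_union_le A₁ A₂
    have := h ν (by simp) A₁ h₁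
    have := ih (fun μ hμ => h μ (by simp [hμ])) h₂
    rw [List.length_cons, add_mul]
    omega

end RandomSets

/-! ### Threshold sets -/

section Threshold

/-- If a signed weight has nonpositive total on every superlevel set of a nonnegative function,
then the function has nonpositive weighted sum. -/
lemma sum_mul_nonpos_of_superlevel {α : Type*} (R : Finset α) (f g : α → ℝ)
    (hf : ∀ x ∈ R, 0 ≤ f x) (h : ∀ t, 0 ≤ t → ∑ x ∈ R with t < f x, g x ≤ 0) :
    ∑ x ∈ R, f x * g x ≤ 0 := by
  induction R using Finset.strongInduction generalizing f with
  | H R ih =>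
  by_cases h0 : ∃ x ∈ R, f x = 0
  · obtain ⟨x, hx, hfx⟩ := h0
    have key := ih (R.filter (0 < f ·)) (Finset.filter_ssubset.2 ⟨x, hx, by simp [hfx]⟩) f
      (fun y hy => hf y (Finset.mem_filter.1 hy).1) fun t ht => by
        rw [Finset.filter_filter]
        convert h t ht using 2
        ext y
        simp only [Finset.mem_filter]
        exact ⟨fun H => ⟨H.1, H.2.2⟩, fun H => ⟨H.1, ht.trans_lt H.2, H.2⟩⟩
    rw [Finset.sum_filter] at key
    refine le_of_eq_of_le (Finset.sum_congr rfl fun y hy => ?_) key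
    split_ifs with hy0
    · rfl
    · rw [le_antisymm (not_lt.1 hy0) (hf y hy), zero_mul]
  · push Not at h0
    rcases R.eq_empty_or_nonempty with rfl | hne
    · simp
    -- Lowering `f` by its minimum makes it vanish somewhere and only shifts the thresholds.
    obtain ⟨m, hm, hmin⟩ := R.exists_min_image f hne
    have hpos : 0 < f m := lt_of_le_of_ne (hf m hm) (h0 m hm).symm
    have key := ih (R.filter (f m < f ·)) (Finset.filter_ssubset.2 ⟨m, hm, by simp⟩)
      (fun x => f x - f m) (fun y hy => by
        have := hmin y (Finset.mem_filter.1 hy).1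
        linarith) fun t ht => by
        rw [Finset.filter_filter]
        convert h (t + f m) (by linarith) using 2
        ext y
        simp only [Finset.mem_filter]
        exact ⟨fun H => ⟨H.1, by linarith [H.2.2]⟩, fun H => ⟨H.1, by linarith, by linarith⟩⟩
    have htot : ∑ x ∈ R, g x ≤ 0 := by
      have := h 0 le_rfl
      rwa [Finset.filter_true_of_mem fun y hy => hpos.trans_le (hmin y hy)] at this
    rw [Finset.sum_filter] at key
    have e : ∑ x ∈ R, f x * g x = f m * ∑ x ∈ R, g x + ∑ x ∈ R, (f x - f m) * g x := by
      rw [Finset.mul_sum, ← Finset.sum_add_distrib]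
      exact Finset.sum_congr rfl fun x _ => by ring
    have e' : ∑ x ∈ R, (f x - f m) * g x ≤ 0 := by
      refine le_of_eq_of_le (Finset.sum_congr rfl fun y hy => ?_) key
      split_ifs with hy0
      · rfl
      · rw [le_antisymm (not_lt.1 hy0) (hmin y hy), sub_self, zero_mul]
    rw [e]
    nlinarith

/-- A subset carrying half of the mass of `f` is a constant fraction of some superlevel set. -/
lemma exists_superlevel_card {α : Type*} {R G : Finset α} (hG : G ⊆ R) (f : α → ℝ)
    (hf : ∀ x ∈ R, 0 ≤ f x) (hpos : 0 < ∑ x ∈ R, f x) (h : ∑ x ∈ R, f x ≤ 2 * ∑ x ∈ G, f x) :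
    ∃ t : ℝ, (R.filter (t < f ·)).card < 4 * (G.filter (t < f ·)).card := by
  by_contra! hcon
  have key := sum_mul_nonpos_of_superlevel R f (fun x => (if x ∈ G then 4 else 0) - 1) hf
    fun t _ => by
      have h1 : ((G.filter (t < f ·)).card : ℝ) * 4 ≤ (R.filter (t < f ·)).card := by
        exact_mod_cast (mul_comm _ _).trans_le (hcon t)
      have h2 : (R.filter (t < f ·)).filter (· ∈ G) = G.filter (t < f ·) := by
        ext y
        simp only [Finset.mem_filter]
        exact ⟨fun H => ⟨H.2, H.1.2⟩, fun H => ⟨⟨hG H.1, H.2⟩, H.1⟩⟩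
      rw [Finset.sum_sub_distrib, ← Finset.sum_filter, h2]
      simp only [Finset.sum_const, nsmul_eq_mul, mul_one]
      linarith
  have h2 : R.filter (· ∈ G) = G := by
    rw [Finset.filter_mem_eq_inter]
    exact Finset.inter_eq_right.2 hG
  have e : ∑ x ∈ R, f x * ((if x ∈ G then 4 else 0) - 1)
      = 4 * ∑ x ∈ G, f x - ∑ x ∈ R, f x := by
    simp only [mul_sub, mul_one, mul_ite, mul_zero]
    rw [Finset.sum_sub_distrib, ← Finset.sum_filter, h2, Finset.mul_sum]
    simp only [mul_comm]
  rw [e] at key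
  linarith

end Threshold

/-! ### The sampling tree -/

section Algorithm

variable {X : Type u} [Fintype X]

/-- The position of `y` in the ranking reported by `x`. -/
def Profile.rank (P : Profile X) (x y : X) : Fin (Fintype.card X) := (P x).symm y

/-- The last `m` points of `R` in the ranking of `c`. -/
noncomputable def farthest (P : Profile X) (m : ℕ) (R : Finset X) (c : X) : Finset X :=
  R.filter fun x => (R.filter fun y => P.rank c x < P.rank c y).card < m

/-- The points of `R` that rank `c` strictly before `y`. -/
noncomputable def preferring (P : Profile X) (c y : X) (R : Finset X) : Finset X :=
  R.filter fun x => P.rank x c < P.rank x y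

/-- A uniformly random point of `farthest P m R c`, or `c` if there is none. -/
noncomputable def drawFarthest (P : Profile X) (m : ℕ) (R : Finset X) (c : X) : PMF X :=
  if h : (farthest P m R c).Nonempty then PMF.uniformOfFinset _ h else PMF.pure c

/-- The random set of centers chosen for the region `R`, in which `c` is already a center, with
recursion depth `d`. For each scale `2 ^ l`, `l ≤ L`, a second center `y` is drawn `32` times
among the `2 ^ l` points of `R` farthest from `c`; each time `R` is split according to which of
`c`, `y` its points prefer, and both parts are treated recursively. -/
noncomputable def treeSample (P : Profile X) (L : ℕ) : ℕ → Finset X → X → PMF (Finset X)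
  | 0, _, c => PMF.pure {c}
  | d + 1, R, c =>
    unionAll (PMF.pure {c} :: (List.range (L + 1)).map fun l =>
      unionAll (List.replicate 32 ((drawFarthest P (2 ^ l) R c).bind fun y =>
        unionAll [treeSample P L d (preferring P c y R) c,
          treeSample P L d (R \ preferring P c y R) y])))

lemma mem_of_mem_support_treeSample {P : Profile X} {L d : ℕ} {R : Finset X} {c : X}
    {A : Finset X} (hA : A ∈ (treeSample P L d R c).support) : c ∈ A := by
  cases d with
  | zero => simp_all [treeSample]
  | succ d =>
    obtain ⟨A', h', hs⟩ := exists_subset_of_mem_support_unionAll hA List.mem_cons_self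
    rw [PMF.mem_support_pure_iff] at h'
    exact hs (by simp [h'])

lemma card_le_of_mem_support_treeSample {P : Profile X} {L d : ℕ} {R : Finset X} {c : X}
    {A : Finset X} (hA : A ∈ (treeSample P L d R c).support) :
    A.card ≤ (64 * (L + 1) + 1) ^ d := by
  induction d generalizing R c A with
  | zero => simp_all [treeSample]
  | succ d ih =>
    have h1 : 1 ≤ (64 * (L + 1) + 1) ^ d := Nat.one_le_pow _ _ (by omega)
    rw [treeSample, unionAll, PMF.mem_support_bind_iff] at hA
    obtain ⟨A₁, h₁, hA⟩ := hA
    obtain ⟨A₂, h₂, rfl⟩ := (PMF.mem_support_map_iff _ _ _).1 hA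
    rw [PMF.mem_support_pure_iff] at h₁
    have hc : A₁.card = 1 := by simp [h₁]
    have := Finset.card_union_le A₁ A₂
    have h2 : A₂.card ≤ (L + 1) * (32 * (2 * (64 * (L + 1) + 1) ^ d)) := by
      refine (card_le_of_mem_support_unionAll
        (m := 32 * (2 * (64 * (L + 1) + 1) ^ d)) ?_ h₂).trans (by simp)
      intro μ hμ A hA
      obtain ⟨l, -, rfl⟩ := List.mem_map.1 hμ
      refine (card_le_of_mem_support_unionAll
        (m := 2 * (64 * (L + 1) + 1) ^ d) ?_ hA).trans (by simp)
      intro ν hν A hA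
      rw [List.eq_of_mem_replicate hν, PMF.mem_support_bind_iff] at hA
      obtain ⟨y, -, hA⟩ := hA
      refine (card_le_of_mem_support_unionAll
        (m := (64 * (L + 1) + 1) ^ d) ?_ hA).trans (by simp)
      intro ν hν A hA
      simp only [List.mem_cons, List.not_mem_nil, or_false] at hν
      rcases hν with rfl | rfl <;> exact ih hA
    rw [pow_succ]
    nlinarith

lemma card_farthest_le (P : Profile X) (m : ℕ) (R : Finset X) (c : X) :
    (farthest P m R c).card ≤ m := by
  have h := Finset.card_le_card_of_injOn (s := farthest P m R c) (t := Finset.range m)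
    (fun x => (R.filter fun y => P.rank c x < P.rank c y).card)
    (fun x hx => by simpa using (Finset.mem_filter.1 hx).2) ?_
  · simpa using h
  -- A point ranked later has strictly fewer points of `R` behind it.
  have key : ∀ x ∈ R, ∀ x' ∈ R, P.rank c x < P.rank c x' →
      (R.filter fun y => P.rank c x' < P.rank c y).card
        < (R.filter fun y => P.rank c x < P.rank c y).card := by
    intro x _ x' hx' hlt
    refine Finset.card_lt_card ((Finset.ssubset_iff_of_subset ?_).2 ⟨x', ?_, ?_⟩)
    · exact Finset.monotone_filter_right _ fun y _ hy => hlt.trans hy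
    · exact Finset.mem_filter.2 ⟨hx', hlt⟩
    · simp
  intro x hx x' hx' he
  have hx := (Finset.mem_filter.1 hx).1
  have hx' := (Finset.mem_filter.1 hx').1
  rcases lt_trichotomy (P.rank c x) (P.rank c x') with h | h | h
  · exact absurd he (key x hx x' hx' h).ne'
  · exact (P c).symm.injective h
  · exact absurd he (key x' hx' x hx h).ne

lemma subset_farthest (P : Profile X) {m : ℕ} {R H : Finset X} {c : X} (hHR : H ⊆ R)
    (hup : ∀ x ∈ H, ∀ y ∈ R, P.rank c x < P.rank c y → y ∈ H) (hm : H.card ≤ m) :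
    H ⊆ farthest P m R c := by
  intro x hx
  refine Finset.mem_filter.2 ⟨hHR hx, lt_of_lt_of_le (Finset.card_lt_card ?_) hm⟩
  refine (Finset.ssubset_iff_of_subset fun y hy => ?_).2 ⟨x, hx, by simp⟩
  exact hup x hx y (Finset.mem_filter.1 hy).1 (Finset.mem_filter.1 hy).2

lemma toOuterMeasure_uniformOfFinset_compl_le {α : Type*} {T : Finset α} (hT : T.Nonempty)
    (G : Finset α) {a b : ℕ} (hb : b ≠ 0) (h : b * T.card ≤ b * (T ∩ G).card + a * T.card) :
    (PMF.uniformOfFinset T hT).toOuterMeasure (G : Set α)ᶜ ≤ (a : ℝ≥0∞) / b := by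
  rw [PMF.toOuterMeasure_uniformOfFinset_apply]
  have hc : (T.filter (· ∈ (G : Set α)ᶜ)).card + (T ∩ G).card = T.card := by
    have : T.filter (· ∈ (G : Set α)ᶜ) = T \ G := by
      ext
      simp
    rw [this, Finset.card_sdiff_add_card_inter]
  have h' : b * (T.filter (· ∈ (G : Set α)ᶜ)).card ≤ a * T.card := by
    rw [← hc, mul_add] at h
    rw [← hc]
    omega
  rw [ENNReal.div_le_iff (by simpa using hT.ne_empty) (by simp), ← ENNReal.mul_div_right_comm,
    ENNReal.le_div_iff_mul_le (by simp [hb]) (by simp)]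
  norm_cast
  convert (mul_comm _ _).trans_le h'

end Algorithm

/-! ### Consistency -/

section Metric

variable {X : Type u} [Fintype X] [MetricSpace X]

lemma Profile.Consistent.dist_le {P : Profile X} (hP : P.Consistent) {x y y' : X}
    (h : P.rank x y ≤ P.rank x y') : dist x y ≤ dist x y' := by
  rcases h.eq_or_lt with h | h
  · rw [(P x).symm.injective h]
  · simpa [Profile.rank] using hP x _ _ h

lemma Profile.Consistent.dist_le_of_mem_preferring {P : Profile X} (hP : P.Consistent)
    {R : Finset X} {c y x : X} (h : x ∈ preferring P c y R) : dist x c ≤ dist x y :=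
  hP.dist_le (Finset.mem_filter.1 h).2.le

lemma Profile.Consistent.dist_le_of_mem_sdiff_preferring {P : Profile X} (hP : P.Consistent)
    {R : Finset X} {c y x : X} (h : x ∈ R \ preferring P c y R) : dist x y ≤ dist x c := by
  rw [Finset.mem_sdiff, preferring, Finset.mem_filter] at h
  exact hP.dist_le (not_lt.1 fun hlt => h.2 ⟨h.1, hlt⟩)

/-- If `G` carries half of the cost of serving `R` from `c`, then at some scale a random far
point lies in `G` with probability at least `1 / 8`. -/
lemma exists_scale_drawFarthest {P : Profile X} (hP : P.Consistent) {L : ℕ}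
    (hL : Fintype.card X ≤ 2 ^ L) {R G : Finset X} (hG : G ⊆ R) (c : X) (z : ℕ)
    (hpos : 0 < ∑ x ∈ R, dist x c ^ z)
    (h : ∑ x ∈ R, dist x c ^ z ≤ 2 * ∑ x ∈ G, dist x c ^ z) :
    ∃ l ≤ L, (drawFarthest P (2 ^ l) R c).toOuterMeasure (G : Set X)ᶜ ≤ 7 / 8 := by
  obtain ⟨t, ht⟩ := exists_superlevel_card hG (fun x => dist x c ^ z)
    (fun x _ => by positivity) hpos h
  set H := R.filter (t < dist · c ^ z) with hH
  set K := G.filter (t < dist · c ^ z) with hK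
  have hKH : K ⊆ H := Finset.filter_subset_filter _ hG
  have hH1 : 1 ≤ H.card := by
    have := Finset.card_le_card hKH
    omega
  have hHT : H ⊆ farthest P (2 ^ Nat.clog 2 H.card) R c := by
    refine subset_farthest P (Finset.filter_subset _ _) ?_ (Nat.le_pow_clog one_lt_two _)
    intro x hx y hy hxy
    refine Finset.mem_filter.2 ⟨hy, (Finset.mem_filter.1 hx).2.trans_le ?_⟩
    have := hP.dist_le hxy.le
    rw [dist_comm x c, dist_comm y c]
    gcongr
  have hT : (farthest P (2 ^ Nat.clog 2 H.card) R c).card ≤ 2 * H.card := by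
    refine (card_farthest_le _ _ _ _).trans ?_
    rcases hH1.eq_or_lt with h1 | h1
    · simp [← h1]
    · have := Nat.pow_pred_clog_lt_self one_lt_two h1
      have hp : 0 < Nat.clog 2 H.card := Nat.clog_pos one_lt_two h1
      calc 2 ^ Nat.clog 2 H.card = 2 * 2 ^ (Nat.clog 2 H.card).pred := by
            rw [← pow_succ', ← Nat.succ_eq_add_one, Nat.succ_pred hp.ne']
        _ ≤ _ := by omega
  have hTne : (farthest P (2 ^ Nat.clog 2 H.card) R c).Nonempty :=
    (Finset.card_pos.1 hH1).mono hHT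
  refine ⟨Nat.clog 2 H.card, Nat.clog_le_of_le_pow ((Finset.card_le_univ _).trans hL), ?_⟩
  rw [drawFarthest, dif_pos hTne]
  refine (toOuterMeasure_uniformOfFinset_compl_le hTne G (a := 7) (b := 8) (by norm_num) ?_).trans
    (by norm_num)
  have : K.card ≤ (farthest P (2 ^ Nat.clog 2 H.card) R c ∩ G).card :=
    Finset.card_le_card fun x hx =>
      Finset.mem_inter.2 ⟨hHT (hKH hx), (Finset.mem_filter.1 hx).1⟩
  omega

end Metric

/-! ### Distance-weighted sampling finds good centers -/

section GoodMass

variable {X : Type u} [MetricSpace X]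

lemma dist_pow_le (z : ℕ) (x y o : X) :
    dist x y ^ z ≤ 2 ^ z * (dist x o ^ z + dist y o ^ z) := by
  calc dist x y ^ z ≤ (dist x o + dist y o) ^ z := by
        gcongr
        exact dist_triangle_right _ _ _
    _ ≤ 2 ^ (z - 1) * (dist x o ^ z + dist y o ^ z) := add_pow_le dist_nonneg dist_nonneg z
    _ ≤ _ := by
        gcongr
        · norm_num
        · omega

/-- The points of `Y` lying, up to the factor `16`, no farther from `u` than the average
point of `Y`, in the sense of `z`-th powers. -/
noncomputable def core (z : ℕ) (Y : Finset X) (u : X) : Finset X :=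
  Y.filter fun y => dist y u ^ z * Y.card ≤ 16 ^ z * ∑ x ∈ Y, dist x u ^ z

/-- Markov's inequality: at most a `16⁻ᶻ` fraction of the points lies outside the core. -/
lemma card_sdiff_core_mul_le (z : ℕ) (Y : Finset X) (u : X) :
    ((Y \ core z Y u).card : ℝ) * 16 ^ z ≤ Y.card := by
  set W := ∑ x ∈ Y, dist x u ^ z with hW
  have hw : ∀ x ∈ Y, dist x u ^ z ≤ W := fun x hx =>
    Finset.single_le_sum (f := fun x => dist x u ^ z) (fun _ _ => by positivity) hx
  have hbad : ∀ y ∈ Y \ core z Y u, 16 ^ z * W < dist y u ^ z * Y.card := fun y hy => by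
    rw [Finset.mem_sdiff, core, Finset.mem_filter] at hy
    exact not_le.1 fun h => hy.2 ⟨hy.1, h⟩
  rcases (Y \ core z Y u).eq_empty_or_nonempty with he | ⟨y, hy⟩
  · simp [he]
  have hY := (Finset.mem_sdiff.1 hy).1
  have hW0 : 0 < W := by
    have h1 := hbad y hy
    have h2 := hw y hY
    have h3 : (0 : ℝ) ≤ 16 ^ z * W := by positivity
    have h4 : 0 < dist y u ^ z := pos_of_mul_pos_left (h3.trans_lt h1) (by positivity)
    linarith
  have h1 : ((Y \ core z Y u).card : ℝ) * (16 ^ z * W) ≤ W * Y.card := by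
    calc ((Y \ core z Y u).card : ℝ) * (16 ^ z * W)
        = ∑ y ∈ Y \ core z Y u, 16 ^ z * W := by simp
      _ ≤ ∑ y ∈ Y \ core z Y u, dist y u ^ z * Y.card :=
          Finset.sum_le_sum fun y hy => (hbad y hy).le
      _ = (∑ y ∈ Y \ core z Y u, dist y u ^ z) * Y.card := by rw [Finset.sum_mul]
      _ ≤ W * Y.card := by
          gcongr
          exact Finset.sum_le_sum_of_subset_of_nonneg Finset.sdiff_subset
            fun _ _ _ => by positivity
  refine le_of_mul_le_mul_right ?_ hW0
  linarith

/-- Few points lie outside the core, and each costs at most a constant factor more than a typical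
point, unless it pays for itself by being far from `u`. -/
lemma sum_sdiff_core_le {z : ℕ} (hz : 1 ≤ z) (Y : Finset X) (u c : X) :
    ∑ y ∈ Y \ core z Y u, dist y c ^ z ≤
      2 ^ z * ∑ x ∈ Y, dist x u ^ z
        + (∑ x ∈ Y, dist x u ^ z + ∑ x ∈ Y, dist x c ^ z) / 4 := by
  set W := ∑ x ∈ Y, dist x u ^ z with hW
  set F := ∑ x ∈ Y, dist x c ^ z with hF
  set N := ((Y \ core z Y u).card : ℝ) with hN
  set D := dist c u ^ z with hD
  have hD0 : 0 ≤ D := by positivity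
  have hW0 : 0 ≤ W := Finset.sum_nonneg fun _ _ => by positivity
  have hF0 : 0 ≤ F := Finset.sum_nonneg fun _ _ => by positivity
  have h1 : ∑ y ∈ Y \ core z Y u, dist y c ^ z ≤ 2 ^ z * W + 2 ^ z * (N * D) := by
    calc ∑ y ∈ Y \ core z Y u, dist y c ^ z
        ≤ ∑ y ∈ Y \ core z Y u, 2 ^ z * (dist y u ^ z + D) :=
          Finset.sum_le_sum fun y _ => dist_pow_le z y c u
      _ = 2 ^ z * ∑ y ∈ Y \ core z Y u, dist y u ^ z + 2 ^ z * (N * D) := by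
          rw [← Finset.mul_sum, Finset.sum_add_distrib, Finset.sum_const, nsmul_eq_mul, mul_add]
      _ ≤ _ := by
          gcongr
          exact Finset.sum_le_sum_of_subset_of_nonneg Finset.sdiff_subset
            fun _ _ _ => by positivity
  have h2 : (Y.card : ℝ) * D ≤ 2 ^ z * (W + F) := by
    calc (Y.card : ℝ) * D = ∑ x ∈ Y, D := by simp
      _ ≤ ∑ x ∈ Y, 2 ^ z * (dist x u ^ z + dist x c ^ z) := by
          refine Finset.sum_le_sum fun x _ => ?_
          have := dist_pow_le z c u x
          rw [dist_comm c x, dist_comm u x] at this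
          linarith
      _ = _ := by rw [← Finset.mul_sum, Finset.sum_add_distrib]
  have h3 : N * D * 16 ^ z ≤ 2 ^ z * (W + F) := by
    have := mul_le_mul_of_nonneg_right (card_sdiff_core_mul_le z Y u) hD0
    linarith
  have h4 : 2 ^ z * (N * D) * 4 ^ z ≤ W + F := by
    have e : (16 : ℝ) ^ z = 2 ^ z * 2 ^ z * 4 ^ z := by
      rw [← mul_pow, ← mul_pow]
      norm_num
    refine le_of_mul_le_mul_left ?_ (show (0 : ℝ) < 2 ^ z by positivity)
    calc _ = N * D * 16 ^ z := by rw [e]; ring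
      _ ≤ _ := h3
  have h5 : (4 : ℝ) ≤ 4 ^ z := by
    simpa using pow_le_pow_right₀ (show (1 : ℝ) ≤ 4 by norm_num) hz
  have h6 : 0 ≤ 2 ^ z * (N * D) := by positivity
  nlinarith

/-- The part of `R` assigned to `u` by `o`. -/
noncomputable def cluster (o : X → X) (R : Finset X) (u : X) : Finset X :=
  R.filter (o · = u)

/-- The budget of `R` when the clusters in `S` are not yet covered: a point of an uncovered
cluster has twice its optimal cost, any other point `x` has `b x`. -/
noncomputable def budget (z : ℕ) (o : X → X) (R S : Finset X) (b : X → ℝ) : ℝ :=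
  ∑ x ∈ R, if o x ∈ S then 2 * dist x (o x) ^ z else b x

/-- The points of `R` in the core of their own uncovered cluster. -/
noncomputable def goodPoints (z : ℕ) (o : X → X) (R S : Finset X) : Finset X :=
  R.filter fun y => o y ∈ S ∧ y ∈ core z (cluster o R (o y)) (o y)

/-- If the center `c` is too expensive for `R`, at least half of its cost is due to the cores of
uncovered clusters. -/
lemma sum_le_two_mul_sum_goodPoints {z : ℕ} (hz : 1 ≤ z) (o : X → X) (R S : Finset X) (c : X)
    (b : X → ℝ) (hb : ∀ x, 0 ≤ b x) (hcov : ∀ x ∈ R, o x ∉ S → dist x c ^ z ≤ 32 ^ z * b x)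
    (hbig : 256 ^ z * budget z o R S b < ∑ x ∈ R, dist x c ^ z) :
    ∑ x ∈ R, dist x c ^ z ≤ 2 * ∑ x ∈ goodPoints z o R S, dist x c ^ z := by
  set F := ∑ x ∈ R, dist x c ^ z with hF
  set β := budget z o R S b with hβ
  set U := R.filter (o · ∈ S) with hU
  set V := R.filter (o · ∉ S) with hV
  set w : X → ℝ := fun x => dist x (o x) ^ z with hw
  have hw0 : ∀ x, 0 ≤ w x := fun x => by positivity
  have hβe : β = 2 * ∑ x ∈ U, w x + ∑ x ∈ V, b x := by
    rw [hβ, budget, Finset.sum_ite, Finset.mul_sum]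
  have hWU : 0 ≤ ∑ x ∈ U, w x := Finset.sum_nonneg fun x _ => hw0 x
  have hBV : 0 ≤ ∑ x ∈ V, b x := Finset.sum_nonneg fun x _ => hb x
  have hsplit : F = ∑ x ∈ U, dist x c ^ z + ∑ x ∈ V, dist x c ^ z :=
    (Finset.sum_filter_add_sum_filter_not _ _ _).symm
  have hFV0 : 0 ≤ ∑ x ∈ V, dist x c ^ z := Finset.sum_nonneg fun _ _ => by positivity
  have hgood : ∑ x ∈ U, dist x c ^ z = ∑ x ∈ goodPoints z o R S, dist x c ^ z
      + ∑ x ∈ U \ goodPoints z o R S, dist x c ^ z := by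
    rw [add_comm, Finset.sum_sdiff]
    exact Finset.monotone_filter_right _ fun x _ h => h.1
  have hVle : ∑ x ∈ V, dist x c ^ z ≤ 32 ^ z * ∑ x ∈ V, b x := by
    rw [Finset.mul_sum]
    exact Finset.sum_le_sum fun x hx =>
      hcov x (Finset.mem_filter.1 hx).1 (Finset.mem_filter.1 hx).2
  have hbad : ∑ x ∈ U \ goodPoints z o R S, dist x c ^ z ≤
      2 ^ z * ∑ x ∈ U, w x + (∑ x ∈ U, w x + ∑ x ∈ U, dist x c ^ z) / 4 := by
    have fib : ∀ (T : Finset X) (f : X → ℝ), T ⊆ U →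
        ∑ x ∈ T, f x = ∑ u ∈ S, ∑ x ∈ T with o x = u, f x := fun T f hT =>
      (Finset.sum_fiberwise_of_maps_to (fun x hx => (Finset.mem_filter.1 (hT hx)).2) f).symm
    have hUc : ∀ u ∈ S, U.filter (o · = u) = cluster o R u := fun u hu => by
      ext x
      simp only [hU, cluster, Finset.mem_filter]
      exact ⟨fun h => ⟨h.1.1, h.2⟩, fun h => ⟨⟨h.1, h.2 ▸ hu⟩, h.2⟩⟩
    rw [fib _ _ Finset.sdiff_subset, fib U w subset_rfl, fib U _ subset_rfl,
      ← Finset.sum_add_distrib, Finset.sum_div, Finset.mul_sum, ← Finset.sum_add_distrib]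
    refine Finset.sum_le_sum fun u hu => ?_
    have e1 : (U \ goodPoints z o R S).filter (o · = u)
        = cluster o R u \ core z (cluster o R u) u := by
      rw [← hUc u hu]
      ext x
      simp only [Finset.mem_filter, Finset.mem_sdiff, goodPoints]
      constructor
      · rintro ⟨⟨h1, h2⟩, rfl⟩
        rw [hUc _ hu]
        exact ⟨⟨h1, rfl⟩, fun h => h2 ⟨(Finset.mem_filter.1 h1).1, hu, h⟩⟩
      · rintro ⟨⟨h1, rfl⟩, h2⟩
        rw [hUc _ hu] at h2
        exact ⟨⟨h1, fun h => h2 h.2.2⟩, rfl⟩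
    have e2 : ∑ x ∈ cluster o R u, w x = ∑ x ∈ cluster o R u, dist x u ^ z :=
      Finset.sum_congr rfl fun x hx => by rw [hw, ← (Finset.mem_filter.1 hx).2]
    rw [e1, hUc u hu, e2]
    exact sum_sdiff_core_le hz _ u c
  have p8 : (32 : ℝ) ^ z * 8 ≤ 256 ^ z := by
    have : (8 : ℝ) ≤ 8 ^ z := by
      simpa using pow_le_pow_right₀ (show (1 : ℝ) ≤ 8 by norm_num) hz
    calc (32 : ℝ) ^ z * 8 ≤ 32 ^ z * 8 ^ z := by gcongr
      _ = _ := by rw [← mul_pow]; norm_num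
  have p128 : (2 : ℝ) ^ z * 128 ≤ 256 ^ z := by
    have : (128 : ℝ) ≤ 128 ^ z := by
      simpa using pow_le_pow_right₀ (show (1 : ℝ) ≤ 128 by norm_num) hz
    calc (2 : ℝ) ^ z * 128 ≤ 2 ^ z * 128 ^ z := by gcongr
      _ = _ := by rw [← mul_pow]; norm_num
  have p1 : (1 : ℝ) ≤ 2 ^ z := one_le_pow₀ (by norm_num)
  have q1 : 32 ^ z * (∑ x ∈ V, b x) * 8 ≤ 256 ^ z * ∑ x ∈ V, b x := by
    have := mul_le_mul_of_nonneg_right p8 hBV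
    linarith
  have q2 : 2 ^ z * (∑ x ∈ U, w x) * 128 ≤ 256 ^ z * ∑ x ∈ U, w x := by
    have := mul_le_mul_of_nonneg_right p128 hWU
    linarith
  have q3 : ∑ x ∈ U, w x ≤ 2 ^ z * ∑ x ∈ U, w x := le_mul_of_one_le_left hWU p1
  have q4 : 256 ^ z * β = 2 * (256 ^ z * ∑ x ∈ U, w x) + 256 ^ z * ∑ x ∈ V, b x := by
    rw [hβe]
    ring
  have q5 : (0 : ℝ) ≤ 256 ^ z * ∑ x ∈ V, b x := by positivity
  have q6 : (0 : ℝ) ≤ 256 ^ z * ∑ x ∈ U, w x := by positivity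
  linarith

/-- At least half of all points lie in the cores of their clusters. -/
lemma card_le_two_mul_card_goodPoints [Fintype X] {z : ℕ} (hz : 1 ≤ z) {O : Finset X} {o : X → X}
    (ho : ∀ x, o x ∈ O) :
    Fintype.card X ≤ 2 * (goodPoints z o Finset.univ O).card := by
  set G := goodPoints z o Finset.univ O with hG
  have h16 : (16 : ℝ) ≤ 16 ^ z := by
    simpa using pow_le_pow_right₀ (show (1 : ℝ) ≤ 16 by norm_num) hz
  have hbad : ∀ u ∈ O, (((Finset.univ \ G).filter (o · = u)).card : ℝ) * 16 ≤
      (Finset.univ.filter (o · = u)).card := fun u _ => by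
    refine le_trans ?_ (card_sdiff_core_mul_le z (cluster o Finset.univ u) u)
    gcongr
    intro x hx
    obtain ⟨h1, rfl⟩ := Finset.mem_filter.1 hx
    rw [Finset.mem_sdiff] at h1 ⊢
    exact ⟨Finset.mem_filter.2 ⟨Finset.mem_univ _, rfl⟩, fun h => h1.2
      (Finset.mem_filter.2 ⟨Finset.mem_univ _, ho x, h⟩)⟩
  have h1 : ((Finset.univ \ G).card : ℝ) * 16 ≤ (Finset.univ : Finset X).card := by
    rw [Finset.card_eq_sum_card_fiberwise (f := o) (s := Finset.univ \ G) (t := O)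
        fun x _ => ho x,
      Finset.card_eq_sum_card_fiberwise (f := o) (s := Finset.univ) (t := O) fun x _ => ho x]
    push_cast
    rw [Finset.sum_mul]
    exact Finset.sum_le_sum hbad
  have h2 : (Finset.univ \ G).card * 16 ≤ (Finset.univ : Finset X).card := by exact_mod_cast h1
  have h3 := Finset.card_sdiff_add_card_eq_card (Finset.subset_univ G)
  rw [← Finset.card_univ]
  omega

end GoodMass

/-! ### Success probability of the sampling tree -/

section Success

variable {X : Type u} [MetricSpace X]

/-- The points of `R` can be served by `A` so that the `z`-th powers of the distances sum to at
most `M`. -/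
def Served (R : Finset X) (z : ℕ) (M : ℝ) (A : Finset X) : Prop :=
  ∃ f : X → X, (∀ x ∈ R, f x ∈ A) ∧ ∑ x ∈ R, dist x (f x) ^ z ≤ M

lemma Served.mono {R : Finset X} {z : ℕ} {M : ℝ} (A A' : Finset X) (h : A ⊆ A')
    (hA : Served R z M A) : Served R z M A' :=
  let ⟨f, hf, hM⟩ := hA
  ⟨f, fun x hx => h (hf x hx), hM⟩

lemma Served.of_sdiff {R R' : Finset X} (hR : R' ⊆ R) {z : ℕ} {M₁ M₂ : ℝ} {A : Finset X}
    (h₁ : Served R' z M₁ A) (h₂ : Served (R \ R') z M₂ A) : Served R z (M₁ + M₂) A := by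
  obtain ⟨f, hf, hM⟩ := h₁
  obtain ⟨g, hg, hM'⟩ := h₂
  refine ⟨fun x => if x ∈ R' then f x else g x, fun x hx => ?_, ?_⟩
  · dsimp only
    split_ifs with h
    · exact hf x h
    · exact hg x (Finset.mem_sdiff.2 ⟨hx, h⟩)
  · rw [← Finset.sum_sdiff hR, add_comm]
    refine add_le_add (le_of_eq_of_le (Finset.sum_congr rfl fun x hx => ?_) hM)
      (le_of_eq_of_le (Finset.sum_congr rfl fun x hx => ?_) hM')
    · dsimp only
      rw [if_pos hx]
    · dsimp only
      rw [if_neg (Finset.mem_sdiff.1 hx).2]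

lemma failProb_served_le {R R' : Finset X} (hR : R' ⊆ R) {z : ℕ} {M₁ M₂ : ℝ}
    (μ : PMF (Finset X)) :
    failProb μ (Served R z (M₁ + M₂)) ≤
      failProb μ (Served R' z M₁) + failProb μ (Served (R \ R') z M₂) := by
  refine (MeasureTheory.measure_mono fun A hA => ?_).trans (MeasureTheory.measure_union_le _ _)
  by_contra h
  simp only [Set.mem_union, Set.mem_ofPred_eq, not_or, not_not] at h
  exact hA (Served.of_sdiff hR h.1 h.2)

/-- The budgets after the cluster of `u` has been covered: its points receive, besides their
optimal cost, the average optimal cost of their cluster. -/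
noncomputable def coverBudget (z : ℕ) (o : X → X) (R : Finset X) (b : X → ℝ) (u : X) (x : X) : ℝ :=
  if o x = u then
    dist x u ^ z + (∑ x' ∈ cluster o R u, dist x' u ^ z) / (cluster o R u).card
  else b x

lemma coverBudget_nonneg (z : ℕ) (o : X → X) (R : Finset X) {b : X → ℝ} (hb : ∀ x, 0 ≤ b x)
    (u x : X) : 0 ≤ coverBudget z o R b u x := by
  unfold coverBudget
  split_ifs
  · have : 0 ≤ ∑ x' ∈ cluster o R u, dist x' u ^ z := Finset.sum_nonneg fun _ _ => by positivity
    positivity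
  · exact hb x

/-- Covering a cluster does not change the total budget. -/
lemma budget_coverBudget (z : ℕ) (o : X → X) (R S : Finset X) (b : X → ℝ) {u : X} (hu : u ∈ S)
    (hne : (cluster o R u).Nonempty) :
    budget z o R (S.erase u) (coverBudget z o R b u) = budget z o R S b := by
  have hc : ((cluster o R u).card : ℝ) ≠ 0 := by simpa using hne.ne_empty
  unfold budget
  rw [← Finset.sum_filter_add_sum_filter_not R (o · = u),
    ← Finset.sum_filter_add_sum_filter_not R (o · = u)]
  congr 1
  · change ∑ x ∈ cluster o R u, _ = ∑ x ∈ cluster o R u, _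
    have h1 : ∀ x ∈ cluster o R u, o x = u := fun x hx => (Finset.mem_filter.1 hx).2
    set m := (∑ x ∈ cluster o R u, dist x u ^ z) / (cluster o R u).card with hm
    have e1 : ∀ x ∈ cluster o R u, (if o x ∈ S.erase u then 2 * dist x (o x) ^ z
        else coverBudget z o R b u x) = dist x u ^ z + m := fun x hx => by
      rw [coverBudget, h1 x hx, if_neg (by simp), if_pos rfl]
    have e2 : ∀ x ∈ cluster o R u, (if o x ∈ S then 2 * dist x (o x) ^ z else b x)
        = 2 * dist x u ^ z := fun x hx => by rw [h1 x hx, if_pos hu]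
    rw [Finset.sum_congr rfl e1, Finset.sum_congr rfl e2, Finset.sum_add_distrib,
      Finset.sum_const, nsmul_eq_mul, mul_div_cancel₀ _ hc, ← Finset.mul_sum, two_mul]
  · refine Finset.sum_congr rfl fun x hx => ?_
    have hx := (Finset.mem_filter.1 hx).2
    simp [coverBudget, hx]

/-- A center in the core of its cluster keeps the whole cluster within its new budget; the factor is
`32 = 2 * 16`, from the triangle inequality and the definition of `core`. -/
lemma dist_pow_le_coverBudget {z : ℕ} {o : X → X} {R : Finset X} {b : X → ℝ} {x y : X}
    (hy : y ∈ core z (cluster o R (o y)) (o y)) (hx : o x = o y) :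
    dist x y ^ z ≤ 32 ^ z * coverBudget z o R b (o y) x := by
  have hyc := (Finset.mem_filter.1 hy).1
  have hc : (0 : ℝ) < (cluster o R (o y)).card := by
    exact_mod_cast Finset.card_pos.2 ⟨y, hyc⟩
  rw [coverBudget, if_pos hx]
  set W := ∑ x' ∈ cluster o R (o y), dist x' (o y) ^ z with hW
  have h1 : dist y (o y) ^ z ≤ 16 ^ z * (W / (cluster o R (o y)).card) := by
    rw [← mul_div_assoc, le_div_iff₀ hc]
    exact (Finset.mem_filter.1 hy).2
  have h16 : (1 : ℝ) ≤ 16 ^ z := one_le_pow₀ (by norm_num)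
  have h2 : dist x (o y) ^ z ≤ 16 ^ z * dist x (o y) ^ z :=
    le_mul_of_one_le_left (by positivity) h16
  calc dist x y ^ z ≤ 2 ^ z * (dist x (o y) ^ z + dist y (o y) ^ z) := dist_pow_le z x y _
    _ ≤ 2 ^ z * (16 ^ z * dist x (o y) ^ z + 16 ^ z * (W / (cluster o R (o y)).card)) := by
        gcongr
    _ = 32 ^ z * (dist x (o y) ^ z + W / (cluster o R (o y)).card) := by
        rw [← mul_add, ← mul_assoc, ← mul_pow]
        norm_num

lemma budget_add_budget_sdiff (z : ℕ) (o : X → X) {R R' : Finset X} (hR : R' ⊆ R) (S : Finset X)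
    (b : X → ℝ) : budget z o R' S b + budget z o (R \ R') S b = budget z o R S b := by
  rw [add_comm, budget, budget, budget, Finset.sum_sdiff hR]

variable [Fintype X]

/-- A draw hits a good point with probability `1 / 8`, and both subtrees then succeed with
probability `1 / 2`, so that `32` independent draws all fail with probability at most `1 / 4`. -/
lemma failure_pow_le : ((1 : ℝ≥0∞) / 2 + 1 / 2 * (7 / 8)) ^ 32 ≤ 1 / 4 := by
  have h : ((1 : ℝ≥0∞) / 2 + 1 / 2 * (7 / 8)) = ENNReal.ofReal (15 / 16) := by
    rw [← ENNReal.toReal_eq_toReal_iff' (by finiteness) (by finiteness), ENNReal.toReal_add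
      (by finiteness) (by finiteness)]
    simp
    norm_num
  have h' : (1 : ℝ≥0∞) / 4 = ENNReal.ofReal (1 / 4) := by
    rw [← ENNReal.toReal_eq_toReal_iff' (by finiteness) (by finiteness)]
    simp
  rw [h, h', ← ENNReal.ofReal_pow (by norm_num)]
  exact ENNReal.ofReal_le_ofReal (by norm_num)

/-- Suppose that every point of `R` in a cluster outside `S` is within its budget of `c`. Then, if
the depth is at least the number of clusters in `S`, the sampling tree serves `R` within a constant
factor of the total budget, with probability at least `3 / 4`. -/
theorem failProb_treeSample_le {P : Profile X} (hP : P.Consistent) {L : ℕ}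
    (hL : Fintype.card X ≤ 2 ^ L) {z : ℕ} (hz : 1 ≤ z) (o : X → X) (d : ℕ) :
    ∀ (R : Finset X) (c : X) (S : Finset X) (b : X → ℝ), S.card ≤ d → (∀ x, 0 ≤ b x) →
      (∀ x ∈ R, o x ∉ S → dist x c ^ z ≤ 32 ^ z * b x) →
      failProb (treeSample P L d R c) (Served R z (256 ^ z * budget z o R S b)) ≤ 1 / 4 := by
  induction d with
  | zero =>
    intro R c S b hS hb hcov
    obtain rfl : S = ∅ := by simpa using hS
    refine le_of_eq_of_le (failProb_eq_zero fun A hA => ?_) zero_le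
    refine ⟨fun _ => c, fun _ _ => mem_of_mem_support_treeSample hA, ?_⟩
    rw [budget, Finset.mul_sum]
    refine Finset.sum_le_sum fun x hx => (hcov x hx (by simp)).trans ?_
    simp only [Finset.notMem_empty, if_false]
    have := hb x
    gcongr
    norm_num
  | succ d ih =>
    intro R c S b hS hb hcov
    by_cases hbig : ∑ x ∈ R, dist x c ^ z ≤ 256 ^ z * budget z o R S b
    · refine le_of_eq_of_le (failProb_eq_zero fun A hA => ?_) zero_le
      exact ⟨fun _ => c, fun _ _ => mem_of_mem_support_treeSample hA, hbig⟩
    rw [not_le] at hbig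
    have hβ : 0 ≤ budget z o R S b := Finset.sum_nonneg fun x _ => by
      have := hb x
      positivity
    obtain ⟨l, hl, hdraw⟩ := exists_scale_drawFarthest hP hL
      (G := goodPoints z o R S) (Finset.filter_subset _ _) c z
      (lt_of_le_of_lt (by positivity) hbig)
      (sum_le_two_mul_sum_goodPoints hz o R S c b hb hcov hbig)
    rw [treeSample]
    refine (failProb_unionAll_le Served.mono (List.mem_cons_of_mem _
      (List.mem_map_of_mem (a := l) (List.mem_range.2 (by omega))))).trans ?_
    refine (failProb_unionAll_replicate_le Served.mono _ _).trans ?_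
    refine le_trans (pow_le_pow_left' ?_ 32) failure_pow_le
    refine (failProb_bind_le _ _ _ (goodPoints z o R S : Set X) fun y hy => ?_).trans
      (by gcongr)
    -- A good draw covers the cluster of `y`, and no budget is lost when `R` is split.
    obtain ⟨hyR, hyS, hycore⟩ := Finset.mem_filter.1 (Finset.mem_coe.1 hy)
    have hsub : preferring P c y R ⊆ R := Finset.filter_subset _ _
    have hcard : (S.erase (o y)).card ≤ d := by
      rw [Finset.card_erase_of_mem hyS]
      omega
    have hcov' : ∀ x ∈ R, o x ∉ S.erase (o y) →
        (dist x c ^ z ≤ 32 ^ z * coverBudget z o R b (o y) x ∨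
          dist x y ^ z ≤ 32 ^ z * coverBudget z o R b (o y) x ∧ o x = o y) := fun x hx hxS => by
      by_cases hxy : o x = o y
      · exact .inr ⟨dist_pow_le_coverBudget hycore hxy, hxy⟩
      · rw [coverBudget, if_neg hxy]
        exact .inl (hcov x hx fun h => hxS (Finset.mem_erase.2 ⟨hxy, h⟩))
    rw [← budget_coverBudget z o R S b hyS ⟨y, (Finset.mem_filter.1 hycore).1⟩,
      ← budget_add_budget_sdiff z o hsub, mul_add]
    refine (failProb_served_le hsub _).trans ?_
    have h1 := ih (preferring P c y R) c (S.erase (o y)) (coverBudget z o R b (o y)) hcard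
      (coverBudget_nonneg z o R hb _) fun x hx hxS => by
        rcases hcov' x (hsub hx) hxS with h | h
        · exact h
        · have := hP.dist_le_of_mem_preferring hx
          exact le_trans (by gcongr) h.1
    have h2 := ih (R \ preferring P c y R) y (S.erase (o y)) (coverBudget z o R b (o y)) hcard
      (coverBudget_nonneg z o R hb _) fun x hx hxS => by
        rcases hcov' x (Finset.sdiff_subset hx) hxS with h | h
        · have := hP.dist_le_of_mem_sdiff_preferring hx
          exact le_trans (by gcongr) h
        · exact h.1
    calc _ ≤ (1 : ℝ≥0∞) / 4 + 1 / 4 := by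
          refine add_le_add ((failProb_unionAll_le Served.mono ?_).trans h1)
            ((failProb_unionAll_le Served.mono ?_).trans h2)
          · simp
          · simp
      _ = 1 / 2 := by
          rw [ENNReal.div_add_div_same, one_add_one_eq_two, ENNReal.div_eq_div_iff] <;> norm_num

/-- At scale `1` the sampling tree always contains a farthest-first traversal, so every outcome
serves all points within the optimal radius, up to a factor `2`. -/
theorem exists_dist_le_of_mem_support_treeSample {P : Profile X} (hP : P.Consistent) {L : ℕ}
    (o : X → X) {r : ℝ} (hr : ∀ x, dist x (o x) ≤ r) (d : ℕ) :
    ∀ (R : Finset X) (c : X) (S : Finset X), S.card ≤ d →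
      (∀ x ∈ R, o x ∉ S → dist x c ≤ 2 * r) →
      ∀ A ∈ (treeSample P L d R c).support, ∀ x ∈ R, ∃ a ∈ A, dist x a ≤ 2 * r := by
  induction d with
  | zero =>
    intro R c S hS hcov A hA x hx
    obtain rfl : S = ∅ := by simpa using hS
    exact ⟨c, mem_of_mem_support_treeSample hA, hcov x hx (by simp)⟩
  | succ d ih =>
    intro R c S hS hcov A hA x hx
    by_cases hbig : dist x c ≤ 2 * r
    · exact ⟨c, mem_of_mem_support_treeSample hA, hbig⟩
    rw [treeSample] at hA
    obtain ⟨A₁, hA₁, hs₁⟩ := exists_subset_of_mem_support_unionAll hA (List.mem_cons_of_mem _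
      (List.mem_map_of_mem (a := 0) (List.mem_range.2 (by omega))))
    obtain ⟨A₂, hA₂, hs₂⟩ := exists_subset_of_mem_support_unionAll hA₁
      (List.mem_replicate.2 ⟨by norm_num, rfl⟩)
    obtain ⟨y, hy, hA₂⟩ := (PMF.mem_support_bind_iff _ _ _).1 hA₂
    have hne : (farthest P (2 ^ 0) R c).Nonempty := by
      obtain ⟨m, hm, hmax⟩ := R.exists_max_image (P.rank c) ⟨x, hx⟩
      refine ⟨m, Finset.mem_filter.2 ⟨hm, ?_⟩⟩
      rw [Finset.filter_false_of_mem fun y hy => not_lt.2 (hmax y hy)]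
      simp
    rw [drawFarthest, dif_pos hne, PMF.mem_support_uniformOfFinset_iff] at hy
    obtain ⟨hyR, hfar⟩ := Finset.mem_filter.1 hy
    have hfar : ∀ x ∈ R, dist c x ≤ dist c y := fun x hx => hP.dist_le <| not_lt.1 fun h => by
      have : 0 < (R.filter fun x => P.rank c y < P.rank c x).card :=
        Finset.card_pos.2 ⟨x, Finset.mem_filter.2 ⟨hx, h⟩⟩
      simp only [pow_zero] at hfar
      omega
    have hyS : o y ∈ S := by
      by_contra h
      have h1 := hcov y hyR h
      have h2 := hfar x hx
      rw [dist_comm c x, dist_comm c y] at h2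
      exact hbig (h2.trans h1)
    have hcard : (S.erase (o y)).card ≤ d := by
      rw [Finset.card_erase_of_mem hyS]
      omega
    have hcov' : ∀ x ∈ R, o x ∉ S.erase (o y) → dist x c ≤ 2 * r ∨ dist x y ≤ 2 * r := by
      intro x hx hxS
      by_cases hxy : o x = o y
      · right
        have h1 := dist_triangle_right x y (o y)
        have h2 := hr y
        have h3 := hr x
        rw [hxy] at h3
        linarith
      · exact .inl (hcov x hx fun h => hxS (Finset.mem_erase.2 ⟨hxy, h⟩))
    by_cases hxc : x ∈ preferring P c y R
    · obtain ⟨A₃, hA₃, hs₃⟩ := exists_subset_of_mem_support_unionAll hA₂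
        (μ := treeSample P L d (preferring P c y R) c) (by simp)
      obtain ⟨a, ha, hxa⟩ := ih _ c (S.erase (o y)) hcard (fun x hx hxS => by
        have := hP.dist_le_of_mem_preferring hx
        rcases hcov' x (Finset.filter_subset _ _ hx) hxS with h | h <;> linarith) A₃ hA₃ x hxc
      exact ⟨a, hs₁ (hs₂ (hs₃ ha)), hxa⟩
    · obtain ⟨A₃, hA₃, hs₃⟩ := exists_subset_of_mem_support_unionAll hA₂
        (μ := treeSample P L d (R \ preferring P c y R) y) (by simp)
      obtain ⟨a, ha, hxa⟩ := ih _ y (S.erase (o y)) hcard (fun x hx hxS => by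
        have := hP.dist_le_of_mem_sdiff_preferring hx
        rcases hcov' x (Finset.sdiff_subset hx) hxS with h | h <;> linarith) A₃ hA₃ x
        (Finset.mem_sdiff.2 ⟨hx, hxc⟩)
      exact ⟨a, hs₁ (hs₂ (hs₃ ha)), hxa⟩

end Success

/-! ### Probabilities and expectations -/

section Probability

variable {X : Type u}

lemma one_sub_le_prob {μ : PMF (CenterSet X)} {E : Set (CenterSet X)} {a : ℝ}
    (h : prob μ Eᶜ ≤ a) : 1 - a ≤ prob μ E := by
  have h1 : (1 : ℝ≥0∞) ≤ μ.toOuterMeasure E + μ.toOuterMeasure Eᶜ := by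
    rw [← (PMF.toOuterMeasure_apply_eq_one_iff (p := μ) (s := Set.univ)).2 (Set.subset_univ _),
      ← Set.union_compl_self E]
    exact MeasureTheory.measure_union_le _ _
  have hfin : ∀ s, μ.toOuterMeasure s ≠ ∞ := fun s =>
    ((pmf_toOuterMeasure_le_one μ s).trans_lt ENNReal.one_lt_top).ne
  have h2 := (ENNReal.toReal_le_toReal ENNReal.one_ne_top
    (ENNReal.add_ne_top.2 ⟨hfin _, hfin _⟩)).2 h1
  rw [ENNReal.toReal_add (hfin _) (hfin _), ENNReal.toReal_one] at h2
  unfold prob at *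
  linarith

/-- An upper bound for an expectation from a bound `a` on an event and a bound `a + m` off it. -/
lemma expectation_le [Fintype X] {μ : PMF (CenterSet X)} {E : Set (CenterSet X)}
    {f : CenterSet X → ℝ} {a m : ℝ} (hE : ∀ C ∈ E, f C ≤ a) (hs : ∀ C ∈ μ.support, f C ≤ a + m) :
    expectation μ f ≤ a + m * prob μ Eᶜ := by
  have hsum : ∑ C, (μ C).toReal = 1 := by
    rw [← ENNReal.toReal_sum fun C _ => μ.apply_ne_top C, ← tsum_fintype (L := .unconditional _),
      PMF.tsum_coe,
      ENNReal.toReal_one]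
  have hprob : prob μ Eᶜ = ∑ C, if C ∈ E then 0 else (μ C).toReal := by
    rw [prob, PMF.toOuterMeasure_apply_fintype, ENNReal.toReal_sum]
    · refine Finset.sum_congr rfl fun C _ => ?_
      by_cases hC : C ∈ E <;> simp [hC]
    · intro C _
      by_cases hC : C ∈ E <;> simp [hC, μ.apply_ne_top]
  calc expectation μ f
      ≤ ∑ C, (a * (μ C).toReal + m * if C ∈ E then 0 else (μ C).toReal) := by
        refine Finset.sum_le_sum fun C _ => ?_
        have h0 : 0 ≤ (μ C).toReal := ENNReal.toReal_nonneg
        split_ifs with hC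
        · nlinarith [hE C hC]
        · by_cases hμ : μ C = 0
          · simp [hμ]
          · nlinarith [hs C hμ]
    _ = _ := by
        rw [Finset.sum_add_distrib, ← Finset.mul_sum, ← Finset.mul_sum, hsum, ← hprob, mul_one]

end Probability

/-! ### Costs of center sets -/

section Cost

variable {X : Type u}

/-- A finite set as a center set, with a junk value for the empty set. -/
noncomputable def toCenterSet [Nonempty X] (A : Finset X) : CenterSet X :=
  if h : A.Nonempty then ⟨A, h⟩ else ⟨{Classical.arbitrary X}, by simp⟩

lemma toCenterSet_val [Nonempty X] {A : Finset X} (h : A.Nonempty) : (toCenterSet A).1 = A := by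
  rw [toCenterSet, dif_pos h]

variable [MetricSpace X]

lemma distTo_nonneg (x : X) (C : CenterSet X) : 0 ≤ distTo x C :=
  (Finset.le_inf'_iff _ _).2 fun _ _ => dist_nonneg

lemma distTo_le {x c : X} {C : CenterSet X} (hc : c ∈ C.1) : distTo x C ≤ dist x c :=
  Finset.inf'_le _ hc

variable [Fintype X]

lemma cost_nonneg (z : ℕ) (C : CenterSet X) : 0 ≤ cost z C :=
  Real.rpow_nonneg (Finset.sum_nonneg fun x _ => pow_nonneg (distTo_nonneg x C) z) _

lemma cost_pow {z : ℕ} (hz : 1 ≤ z) (C : CenterSet X) : cost z C ^ z = ∑ x, distTo x C ^ z := by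
  rw [cost, one_div, Real.rpow_inv_natCast_pow _ (by omega)]
  exact Finset.sum_nonneg fun x _ => pow_nonneg (distTo_nonneg x C) z

lemma cost_le {z : ℕ} (hz : 1 ≤ z) {C : CenterSet X} {a : ℝ} (ha : 0 ≤ a)
    (h : ∑ x, distTo x C ^ z ≤ a ^ z) : cost z C ≤ a := by
  rw [← cost_pow hz] at h
  exact le_of_pow_le_pow_left₀ (by omega) ha h

/-- An optimal solution, together with the map sending each point to a nearest center. -/
lemma exists_optimal_assignment [Nonempty X] {k z : ℕ} (hk : 1 ≤ k) (hz : 1 ≤ z) :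
    ∃ (O : Finset X) (o : X → X), O.card ≤ k ∧ (∀ x, o x ∈ O) ∧
      ∑ x, dist x (o x) ^ z = optCost X k z ^ z := by
  have : Nonempty {C : CenterSet X // C.1.card ≤ k} :=
    ⟨⟨⟨{Classical.arbitrary X}, by simp⟩, by simpa using hk⟩⟩
  obtain ⟨⟨O, hO⟩, he⟩ :=
    exists_eq_ciInf_of_finite (f := fun C : {C : CenterSet X // C.1.card ≤ k} => cost z C.1)
  choose o ho hd using fun x => Finset.exists_mem_eq_inf' O.2 (fun c => dist x c)
  refine ⟨O.1, o, hO, ho, ?_⟩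
  rw [optCost, ← he, cost_pow hz]
  exact Finset.sum_congr rfl fun x _ => by rw [← hd x]; rfl

lemma optCost_nonneg (k z : ℕ) : 0 ≤ optCost X k z :=
  Real.iInf_nonneg fun C => cost_nonneg z C.1

lemma Served.cost_le [Nonempty X] {A : Finset X} {z : ℕ} (hz : 1 ≤ z) {a : ℝ} (ha : 0 ≤ a)
    (h : Served Finset.univ z (a ^ z) A) : cost z (toCenterSet A) ≤ a := by
  obtain ⟨f, hf, hM⟩ := h
  have hA : A.Nonempty := ⟨_, hf (Classical.arbitrary X) (Finset.mem_univ _)⟩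
  refine OrdinalClustering.cost_le hz ha ((Finset.sum_le_sum fun x hx => ?_).trans hM)
  gcongr
  · exact distTo_nonneg _ _
  · exact distTo_le ((toCenterSet_val hA).symm ▸ hf x hx)

end Cost

/-! ### The algorithm -/

section Main

/-- The number of scales: the number of binary digits of the number of points. -/
def numScales (X : Type u) [Fintype X] : ℕ := Nat.log 2 (Fintype.card X) + 1

lemma card_lt_two_pow_numScales (X : Type u) [Fintype X] :
    Fintype.card X < 2 ^ numScales X :=
  Nat.lt_pow_succ_log_self one_lt_two _

variable {X : Type u} [Fintype X]

lemma numScales_le (hn : 2 ≤ Fintype.card X) :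
    (numScales X : ℝ) ≤ 3 * Real.log (Fintype.card X) := by
  have h2 := Real.log_two_gt_d9
  have h2n : Real.log 2 ≤ Real.log (Fintype.card X) :=
    Real.log_le_log (by norm_num) (by exact_mod_cast hn)
  have h1 : (Nat.log 2 (Fintype.card X) : ℝ) ≤ Real.logb 2 (Fintype.card X) := by
    exact_mod_cast Real.natLog_le_logb (Fintype.card X) 2
  have h3 : Real.logb 2 (Fintype.card X) + 1 ≤ 3 * Real.log (Fintype.card X) := by
    rw [Real.logb, div_add_one (by positivity), div_le_iff₀ (by positivity)]
    nlinarith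
  rw [numScales]
  push_cast
  linarith

lemma card_bound {k : ℕ} (hk : 1 ≤ k) (hn : 2 ≤ Fintype.card X) :
    ((6 * numScales X * (64 * (numScales X + 1) + 1) ^ (k - 1) : ℕ) : ℝ)
      ≤ (400 * Real.log (Fintype.card X)) ^ k := by
  have hL := numScales_le hn
  have hL1 : (1 : ℝ) ≤ numScales X := by
    exact_mod_cast Nat.succ_le_succ (Nat.zero_le _)
  obtain ⟨j, rfl⟩ := Nat.exists_eq_add_of_le' hk
  rw [Nat.add_sub_cancel, pow_succ']
  push_cast
  refine mul_le_mul (by linarith) (pow_le_pow_left₀ (by positivity) (by linarith) _)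
    (by positivity) (by linarith)

variable [Nonempty X]

/-- One run: a sampling tree of depth `k - 1` grown from a uniformly random first center. -/
noncomputable def singleRun (P : Profile X) (k : ℕ) : PMF (Finset X) :=
  (PMF.uniformOfFinset Finset.univ Finset.univ_nonempty).bind fun y =>
    treeSample P (numScales X) (k - 1) Finset.univ y

/-- The union of `O(log n)` independent runs. -/
noncomputable def repeatedRuns (P : Profile X) (k : ℕ) : PMF (Finset X) :=
  unionAll (List.replicate (6 * numScales X) (singleRun P k))

/-- The zero-query algorithm. -/
noncomputable def ordinalAlgorithm : RandomizedOrdinalAlgorithm.{u} :=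
  fun _ _ _ k P => (repeatedRuns P k).map toCenterSet

lemma exists_treeSample_subset {P : Profile X} {k : ℕ} {A : Finset X}
    (hA : A ∈ (repeatedRuns P k).support) :
    ∃ y, ∃ A' ∈ (treeSample P (numScales X) (k - 1) Finset.univ y).support, A' ⊆ A := by
  obtain ⟨A', hA', hs⟩ := exists_subset_of_mem_support_unionAll hA
    (List.mem_replicate.2 ⟨by simp [numScales], rfl⟩)
  obtain ⟨y, -, hA'⟩ := (PMF.mem_support_bind_iff _ _ _).1 hA'
  exact ⟨y, A', hA', hs⟩

lemma nonempty_of_mem_support_repeatedRuns {P : Profile X} {k : ℕ} {A : Finset X}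
    (hA : A ∈ (repeatedRuns P k).support) : A.Nonempty := by
  obtain ⟨y, A', hA', hs⟩ := exists_treeSample_subset hA
  exact ⟨y, hs (mem_of_mem_support_treeSample hA')⟩

lemma card_le_of_mem_support_repeatedRuns {P : Profile X} {k : ℕ} {A : Finset X}
    (hA : A ∈ (repeatedRuns P k).support) :
    A.card ≤ 6 * numScales X * (64 * (numScales X + 1) + 1) ^ (k - 1) := by
  refine (card_le_of_mem_support_unionAll
    (m := (64 * (numScales X + 1) + 1) ^ (k - 1)) ?_ hA).trans (by simp)
  intro μ hμ A hA
  rw [List.eq_of_mem_replicate hμ, singleRun, PMF.mem_support_bind_iff] at hA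
  obtain ⟨y, -, hA⟩ := hA
  exact card_le_of_mem_support_treeSample hA

variable [MetricSpace X]

lemma failProb_singleRun_le {P : Profile X} (hP : P.Consistent) {k z : ℕ}
    (hz : 1 ≤ z) {O : Finset X} {o : X → X} (hO : O.card ≤ k) (ho : ∀ x, o x ∈ O) :
    failProb (singleRun P k) (Served Finset.univ z (256 ^ z * (2 * ∑ x, dist x (o x) ^ z)))
      ≤ 3 / 4 := by
  have hG : (PMF.uniformOfFinset (Finset.univ : Finset X) Finset.univ_nonempty).toOuterMeasure
      (goodPoints z o Finset.univ O : Set X)ᶜ ≤ 1 / 2 := by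
    refine (toOuterMeasure_uniformOfFinset_compl_le _ _ (a := 1) (b := 2) (by norm_num) ?_).trans
      (by norm_num)
    have := card_le_two_mul_card_goodPoints hz ho
    rw [Finset.univ_inter, Finset.card_univ]
    omega
  refine (failProb_bind_le _ _ _ (goodPoints z o Finset.univ O : Set X) fun y hy => ?_).trans
    (?_ : _ ≤ 1 / 2 + 1 / 2 * (1 / 2 : ℝ≥0∞)) |>.trans ?_
  · obtain ⟨-, hyO, hycore⟩ := Finset.mem_filter.1 (Finset.mem_coe.1 hy)
    have hb : 2 * ∑ x, dist x (o x) ^ z = budget z o Finset.univ (O.erase (o y))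
        (coverBudget z o Finset.univ (fun _ => 0) (o y)) := by
      rw [budget_coverBudget z o _ O _ hyO ⟨y, (Finset.mem_filter.1 hycore).1⟩, budget,
        Finset.mul_sum]
      exact Finset.sum_congr rfl fun x _ => (if_pos (ho x)).symm
    rw [hb]
    refine (failProb_treeSample_le hP (card_lt_two_pow_numScales X).le hz o (k - 1) _ y _ _
      ?_ (coverBudget_nonneg z o _ (fun _ => le_rfl) _) ?_).trans ?_
    · rw [Finset.card_erase_of_mem hyO]
      omega
    · intro x _ hx
      exact dist_pow_le_coverBudget hycore
        (by_contra fun h => hx (Finset.mem_erase.2 ⟨h, ho x⟩))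
    · simp only [one_div]
      exact ENNReal.inv_le_inv.2 (by norm_num)
  · gcongr
  · rw [← ENNReal.toReal_le_toReal (by finiteness) (by finiteness), ENNReal.toReal_add
      (by finiteness) (by finiteness)]
    simp
    norm_num

/-- For a fixed exponent, `O(log n)` runs make the failure probability polynomially small. -/
lemma failProb_repeatedRuns_le {P : Profile X} (hP : P.Consistent) {k z : ℕ} (hk : 1 ≤ k)
    (hz : 1 ≤ z) :
    failProb (repeatedRuns P k) (fun A => cost z (toCenterSet A) ≤ 512 * optCost X k z)
      ≤ (1 / 4) ^ numScales X := by
  obtain ⟨O, o, hO, ho, hopt⟩ := exists_optimal_assignment (X := X) hk hz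
  have h0 := optCost_nonneg (X := X) k z
  have key : failProb (repeatedRuns P k)
      (Served Finset.univ z (256 ^ z * (2 * ∑ x, dist x (o x) ^ z))) ≤ (3 / 4) ^ (6 * numScales X) :=
    (failProb_unionAll_replicate_le Served.mono _ _).trans
      (pow_le_pow_left' (failProb_singleRun_le hP hz hO ho) _)
  refine (MeasureTheory.measure_mono fun A (hA : ¬ _) (hS : Served _ _ _ A) => hA ?_).trans
    (key.trans ?_)
  · obtain ⟨f, hf, hM⟩ := hS
    refine Served.cost_le hz (by positivity) ⟨f, hf, hM.trans ?_⟩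
    rw [hopt, mul_pow, ← mul_assoc]
    gcongr
    have h2 : (2 : ℝ) ≤ 2 ^ z := by
      simpa using pow_le_pow_right₀ (show (1 : ℝ) ≤ 2 by norm_num) hz
    calc (256 : ℝ) ^ z * 2 ≤ 256 ^ z * 2 ^ z := by gcongr
      _ = 512 ^ z := by rw [← mul_pow]; norm_num
  · rw [pow_mul]
    refine pow_le_pow_left' ?_ _
    rw [← ENNReal.toReal_le_toReal (by finiteness) (by finiteness)]
    simp
    norm_num

/-- A bound valid for every outcome of the algorithm, since the optimal cost bounds the optimal
covering radius. -/
lemma sum_distTo_pow_le {P : Profile X} (hP : P.Consistent) {k z : ℕ} (hk : 1 ≤ k) (hz : 1 ≤ z)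
    {A : Finset X} (hA : A ∈ (repeatedRuns P k).support) :
    ∑ x, distTo x (toCenterSet A) ^ z ≤ Fintype.card X * (2 * optCost X k z) ^ z := by
  obtain ⟨O, o, hO, ho, hopt⟩ := exists_optimal_assignment (X := X) hk hz
  have h0 := optCost_nonneg (X := X) k z
  have hr : ∀ x, dist x (o x) ≤ optCost X k z := fun x => by
    refine le_of_pow_le_pow_left₀ (by omega : z ≠ 0) h0 ?_
    rw [← hopt]
    exact Finset.single_le_sum (f := fun x => dist x (o x) ^ z) (fun _ _ => by positivity)
      (Finset.mem_univ x)
  obtain ⟨y, A', hA', hs⟩ := exists_treeSample_subset hA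
  have hserve := exists_dist_le_of_mem_support_treeSample hP o hr (k - 1) Finset.univ y
    (O.erase (o y)) (by rw [Finset.card_erase_of_mem (ho y)]; omega) (fun x _ hx => by
      have hxy : o x = o y := by_contra fun h => hx (Finset.mem_erase.2 ⟨h, ho x⟩)
      have h1 := dist_triangle_right x y (o y)
      have h2 := hr y
      have h3 := hr x
      rw [hxy] at h3
      linarith) A' hA'
  rw [← nsmul_eq_mul, ← Finset.card_univ, ← Finset.sum_const]
  refine Finset.sum_le_sum fun x hx => ?_
  obtain ⟨a, ha, hxa⟩ := hserve x hx
  have hA0 := nonempty_of_mem_support_repeatedRuns hA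
  have : distTo x (toCenterSet A) ≤ dist x a :=
    distTo_le ((toCenterSet_val hA0).symm ▸ hs ha)
  have := distTo_nonneg x (toCenterSet A)
  gcongr
  linarith

lemma cost_le_card_mul {P : Profile X} (hP : P.Consistent) {k z : ℕ} (hk : 1 ≤ k) (hz : 1 ≤ z)
    {A : Finset X} (hA : A ∈ (repeatedRuns P k).support) :
    cost z (toCenterSet A) ≤ 2 * Fintype.card X * optCost X k z := by
  have h0 := optCost_nonneg (X := X) k z
  refine cost_le hz (by positivity) ((sum_distTo_pow_le hP hk hz hA).trans ?_)
  have hn : (Fintype.card X : ℝ) ≤ Fintype.card X ^ z :=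
    le_self_pow₀ (Nat.one_le_cast.2 Fintype.card_pos) (by omega)
  calc (Fintype.card X : ℝ) * (2 * optCost X k z) ^ z
      ≤ Fintype.card X ^ z * (2 * optCost X k z) ^ z := by gcongr
    _ = _ := by
        rw [← mul_pow]
        ring

/-- For exponents of order at least `log n`, the cost is comparable to the covering radius. -/
lemma cost_le_of_numScales_le {P : Profile X} (hP : P.Consistent) {k z : ℕ} (hk : 1 ≤ k)
    (hz : numScales X ≤ z) {A : Finset X} (hA : A ∈ (repeatedRuns P k).support) :
    cost z (toCenterSet A) ≤ 512 * optCost X k z := by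
  have hz1 : 1 ≤ z := le_trans (Nat.succ_le_succ (Nat.zero_le _)) hz
  have h0 := optCost_nonneg (X := X) k z
  refine cost_le hz1 (by positivity) ((sum_distTo_pow_le hP hk hz1 hA).trans ?_)
  have h1 : (Fintype.card X : ℝ) ≤ 2 ^ z := by
    exact_mod_cast (card_lt_two_pow_numScales X).le.trans (Nat.pow_le_pow_right two_pos hz)
  calc (Fintype.card X : ℝ) * (2 * optCost X k z) ^ z ≤ 2 ^ z * (2 * optCost X k z) ^ z := by
        gcongr
    _ = (4 * optCost X k z) ^ z := by
        rw [← mul_pow]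
        ring
    _ ≤ _ := by
        gcongr
        norm_num

lemma failProb_repeatedRuns_forall_le {P : Profile X} (hP : P.Consistent) {k : ℕ} (hk : 1 ≤ k) :
    failProb (repeatedRuns P k)
      (fun A => ∀ z : ℕ, 1 ≤ z → cost z (toCenterSet A) ≤ 512 * optCost X k z)
      ≤ (Fintype.card X : ℝ≥0∞)⁻¹ := by
  set L := numScales X with hL
  have hsub : {A | ¬ ∀ z : ℕ, 1 ≤ z → cost z (toCenterSet A) ≤ 512 * optCost X k z} ∩
      (repeatedRuns P k).support ⊆
      ⋃ z ∈ Finset.Ico 1 L, {A | ¬ cost z (toCenterSet A) ≤ 512 * optCost X k z} := by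
    rintro A ⟨hA, hs⟩
    rw [Set.mem_ofPred_eq] at hA
    push Not at hA
    obtain ⟨z, hz, hzA⟩ := hA
    simp only [Set.mem_iUnion]
    refine ⟨z, Finset.mem_Ico.2 ⟨hz, ?_⟩, not_le.2 hzA⟩
    by_contra h
    exact absurd (cost_le_of_numScales_le hP hk (not_lt.1 h) hs) (not_le.2 hzA)
  calc _ ≤ (repeatedRuns P k).toOuterMeasure
        (⋃ z ∈ Finset.Ico 1 L, {A | ¬ cost z (toCenterSet A) ≤ 512 * optCost X k z}) :=
        PMF.toOuterMeasure_mono _ hsub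
    _ ≤ ∑ z ∈ Finset.Ico 1 L, (repeatedRuns P k).toOuterMeasure
          {A | ¬ cost z (toCenterSet A) ≤ 512 * optCost X k z} :=
        MeasureTheory.measure_biUnion_finset_le _ _
    _ ≤ ∑ z ∈ Finset.Ico 1 L, (1 / 4) ^ L := Finset.sum_le_sum fun z hz =>
        failProb_repeatedRuns_le hP hk (Finset.mem_Ico.1 hz).1
    _ ≤ (2 : ℝ≥0∞) ^ L * (1 / 4) ^ L := by
        rw [Finset.sum_const, nsmul_eq_mul]
        gcongr
        have : (Finset.Ico 1 L).card ≤ 2 ^ L := by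
          rw [Nat.card_Ico]
          exact (Nat.sub_le _ _).trans Nat.lt_two_pow_self.le
        exact_mod_cast this
    _ = (2 ^ L : ℝ≥0∞)⁻¹ := by
        rw [← mul_pow, ENNReal.inv_pow]
        congr 1
        rw [← ENNReal.toReal_eq_toReal_iff' (by finiteness) (by finiteness)]
        simp
        norm_num
    _ ≤ _ := by
        rw [ENNReal.inv_le_inv]
        exact_mod_cast (card_lt_two_pow_numScales X).le

lemma prob_ordinalAlgorithm_compl_le {P : Profile X} (hP : P.Consistent) {k : ℕ} (hk : 1 ≤ k) :
    prob (ordinalAlgorithm X k P) {C | ∀ z : ℕ, 1 ≤ z → cost z C ≤ 512 * optCost X k z}ᶜ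
      ≤ 1 / (Fintype.card X : ℝ) := by
  have h := failProb_repeatedRuns_forall_le hP hk
  rw [prob, ordinalAlgorithm, PMF.toOuterMeasure_map_apply, one_div, ← ENNReal.toReal_natCast,
    ← ENNReal.toReal_inv]
  exact ENNReal.toReal_mono (by simp [Fintype.card_ne_zero]) h

end Main

end OrdinalClustering

theorem mainTheorem3 :
    ∃ (D B : ℝ) (ε : ℕ → ℝ), 0 < D ∧ 0 < B ∧ Tendsto ε atTop (𝓝 0) ∧
      ∃ A : OrdinalClustering.RandomizedOrdinalAlgorithm.{u},
        ∀ (X : Type u) [Fintype X] [Nonempty X] [MetricSpace X]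
          (P : OrdinalClustering.Profile X) (k : ℕ),
          2 ≤ Fintype.card X → 1 ≤ k → P.Consistent →
            -- the number of centers, for every outcome of the random choices
            (∀ C ∈ (A X k P).support,
              (C.1.card : ℝ) ≤
                (B * Real.log (Fintype.card X)) ^ ((k : ℝ) + ε (Fintype.card X))) ∧
            -- with high probability, for all `z` simultaneously
            1 - 1 / (Fintype.card X : ℝ) ≤
              OrdinalClustering.prob (A X k P)
                {C | ∀ z : ℕ, 1 ≤ z →
                  OrdinalClustering.cost z C ≤ D * OrdinalClustering.optCost X k z} ∧
            -- in expectation, for every `z`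
            (∀ z : ℕ, 1 ≤ z →
              OrdinalClustering.expectation (A X k P) (OrdinalClustering.cost z) ≤
                D * OrdinalClustering.optCost X k z) := by
  open OrdinalClustering in
  refine ⟨514, 400, fun _ => 0, by norm_num, by norm_num, tendsto_const_nhds, ordinalAlgorithm,
    fun X _ _ _ P k hn hk hP => ⟨fun C hC => ?_, ?_, fun z hz => ?_⟩⟩
  · obtain ⟨A, hA, rfl⟩ := (PMF.mem_support_map_iff _ _ _).1 hC
    rw [toCenterSet_val (nonempty_of_mem_support_repeatedRuns hA), add_zero, Real.rpow_natCast]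
    exact (Nat.cast_le.2 (card_le_of_mem_support_repeatedRuns hA)).trans (card_bound hk hn)
  · refine one_sub_le_prob (le_trans (ENNReal.toReal_mono ?_ (MeasureTheory.measure_mono ?_))
      (prob_ordinalAlgorithm_compl_le hP hk))
    · exact ((pmf_toOuterMeasure_le_one _ _).trans_lt ENNReal.one_lt_top).ne
    · refine Set.compl_subset_compl.2 fun C hC z hz => (hC z hz).trans ?_
      have := optCost_nonneg (X := X) k z
      gcongr
      norm_num
  · have h0 := optCost_nonneg (X := X) k z
    have hn0 : (0 : ℝ) < Fintype.card X := by exact_mod_cast Fintype.card_pos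
    refine (expectation_le (a := 512 * optCost X k z) (m := 2 * Fintype.card X * optCost X k z)
      (E := {C | ∀ z : ℕ, 1 ≤ z → cost z C ≤ 512 * optCost X k z})
      (fun C hC => hC z hz) fun C hC => ?_).trans ?_
    · obtain ⟨A, hA, rfl⟩ := (PMF.mem_support_map_iff _ _ _).1 hC
      have := cost_le_card_mul hP hk hz hA
      linarith
    · calc _ ≤ 512 * optCost X k z
            + 2 * Fintype.card X * optCost X k z * (1 / (Fintype.card X : ℝ)) := by
            gcongr
            exact prob_ordinalAlgorithm_compl_le hP hk
        _ = 514 * optCost X k z := by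
            field_simp
            ring
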